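/- **Setting.** Let $d\ge 1$ and $\mathbb E=\mathbb R^d$ with Euclidean norm $\|\cdot\|$. A chain is a finite sequence $\mathbf P=[p_0;\dots;p_{N-1}]$ of points of $\mathbb E$, of length $\#\mathbf P=N$; $\mathbb E^N$ is the set of chains of length $N$, and $\mathbb E^{\ge n}$ is the set of chains of length at least $n$. Put $(\Delta \mathbf P)_i=p_{i+1}-p_i$, $|\mathbf P|_0=\max_i\|p_i\|$ and $|\mathbf P|_j=|\Delta^j\mathbf P|_0$. Let $\Pi$ be the orthogonal projection of $\mathbb E^n$, with inner product $\sum_i\langle p_i,q_i\rangle$, onto the linear chains $\{\mathbf p\in\mathbb E^n:\Delta^2\mathbf p=0\}$. The relative distortion of $\mathbf p\in\mathbb E^n$ is $\kappa(\mathbf p)=|\mathbf p|_2/|\Pi\mathbf p|_1$ if $\Delta\Pi\mathbf p\ne0$, and $\kappa(\mathbf p)=\infty$ otherwise. For $\mathbf P\in\mathbb E^{\ge n}$, $\kappa(\mathbf P)$ is the maximum of $\kappa(\mathbf p)$ over all subchains $\mathbf p$ of $n$ consecutive points of $\mathbf P$. Let $e=(1,0,\dots,0)\in\mathbb E$ and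 $\mathbf E_N=[e;2e;\dots;Ne]$. **GLUE-schemes.** Let $m\ge1$ and $n=2m+1$. A map $\mathbf G:\mathbb E^{\ge n}\to\mathbb E^{\ge n}$ with $\#\mathbf G(\mathbf P)=2\,\#\mathbf P-n+1$ is a GLUE-scheme with spread $n$ if - (geometric) $\mathbf G$ commutes with all similarities $S(p)=\varrho Qp+s$ (with $\varrho>0$, $Q$ orthogonal, $s\in\mathbb E$), applied pointwise to chains; - (local, uniform) there are functions $g_0,g_1:\mathbb E^{m+1}\to\mathbb E$ such that the points $p'_j$ of $\mathbf G(\mathbf P)$ are $p'_{2i+\lambda}=g_\lambda(p_i,\dots,p_{i+m})$ for $\lambda\in\{0,1\}$, $0\le i<\#\mathbf P-m$, and all $\mathbf P\in\mathbb E^{\ge n}$; and, for some $\nu>0$, both $g_0$ and $g_1$ are $C^{1,\nu}$ (continuously differentiable, with $\nu$-Hölder derivative) in a neighbourhood of $\mathbf E_{m+1}$; - (equilinear) $\mathbf G(\mathbf E_n)=(\mathbf E_{n+1}+(m+\tau)e)/2$ for some $\tau\in[0,1)$, where $(m+\tau)e$ is added to every point. **Straightening.** Put $\mathbf P^\ell=\mathbf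 G^\ell(\mathbf P)=[p_0^\ell;p_1^\ell;\dots]$ and $\kappa_\ell=\kappa(\mathbf P^\ell)\in[0,\infty]$. The chain $\mathbf P$ is *straightened* by $\mathbf G$ if $\kappa_\ell\to0$. It is *strongly straightened* by $\mathbf G$ if there is an $\ell_0$ with $\sum_{\ell\ge\ell_0}\kappa_\ell<\infty$. It is *straightened at rate $\alpha\in(0,1]$* by $\mathbf G$ if there is an $\ell_0$ with $\sup_{\ell\ge\ell_0}2^{\ell\alpha}\kappa_\ell<\infty$. **Convergence and smoothness.** For $N=\#\mathbf P\ge n$, let $I=(0,N-n+1)$ and $I_z=[z,N-n+1-z]$ for $z>0$. The scheme $\mathbf G$ is *convergent at $\mathbf P$* if there is a continuous limit curve $\Phi:\mathbb R\to\mathbb E$ such that, for every $z>0$, $$\lim_{\ell\to\infty}\ \sup_{i\,:\,2^{-\ell}i\in I_z}\bigl\|\Phi(2^{-\ell}i)-p_i^\ell\bigr\|=0 ;$$ such a $\Phi$ is unique on $I$. The scheme is *$C^1$ at $\mathbf P$* if it is convergent at $\mathbf P$ and $\Phi$ is continuously differentiable on $I$. It is *$C^{1,\alpha}$ at $\mathbf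 P$* if, moreover, there is an $h_0>0$ such that, for every $z>0$, $$\sup_{0<h\le h_0}\ h^{-\alpha}\max_{t\in I_{z+h/2}}\|\Phi'(t+h/2)-\Phi'(t-h/2)\|<\infty ,$$ where the maximum over an empty interval is read as $0$. **Theorem.** Let $\mathbf G$ be a GLUE-scheme with spread $n$, and let $\mathbf P\in\mathbb E^{\ge n}$. 1. If $\mathbf P$ is straightened by $\mathbf G$, then $\mathbf G$ is convergent at $\mathbf P$. 2. If $\mathbf P$ is strongly straightened by $\mathbf G$, then $\mathbf G$ is $C^1$ at $\mathbf P$. 3. If $\mathbf P$ is straightened by $\mathbf G$ at rate $\alpha\in(0,1]$, then $\mathbf G$ is $C^{1,\alpha}$ at $\mathbf P$. -/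

import Mathlib

open Filter Topology Set
open scoped NNReal ENNReal

namespace Glue

/-- Euclidean `d`-space. -/
abbrev Pt (d : ℕ) : Type := EuclideanSpace ℝ (Fin d)

/-- The set of chains (finite sequences of points) of length at least `n`. -/
@[ext]
structure Chain (d n : ℕ) where
  /-- The number of points. -/
  len : ℕ
  /-- There are at least `n` points. -/
  le_len : n ≤ len
  /-- The points, indexed from `0`. -/
  pt : Fin len → Pt d

/-- The forward difference operator `(Δ p)_i = p_{i+1} - p_i` on chains with `N` points. -/
def diff (d N : ℕ) : (Fin N → Pt d) →ₗ[ℝ] (Fin (N - 1) → Pt d) where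
  toFun p i := p ⟨(i : ℕ) + 1, by omega⟩ - p ⟨(i : ℕ), by omega⟩
  map_add' p q := by
    funext i
    simp only [Pi.add_apply]
    abel
  map_smul' c p := by
    funext i
    simp only [Pi.smul_apply, RingHom.id_apply, smul_sub]

/-- The semi-norm `|p|_1 = max_i ‖Δ p_i‖` (the norm on `Fin k → Pt d` is the maximum of the
Euclidean norms of the points). -/
noncomputable def norm1 {d N : ℕ} (p : Fin N → Pt d) : ℝ := ‖diff d N p‖

/-- The semi-norm `|p|_2 = max_i ‖Δ² p_i‖`. -/
noncomputable def norm2 {d N : ℕ} (p : Fin N → Pt d) : ℝ := ‖diff d (N - 1) (diff d N p)‖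

/-- The subspace of linear chains, `Δ² p = 0`, inside the space of chains with `n` points, the
latter equipped with the inner product `∑ i, ⟨p_i, q_i⟩`. -/
noncomputable def linearChains (d n : ℕ) : Submodule ℝ (PiLp 2 (fun _ : Fin n => Pt d)) :=
  LinearMap.ker (diff d (n - 1) ∘ₗ diff d n ∘ₗ
    (WithLp.linearEquiv 2 ℝ (Fin n → Pt d)).toLinearMap)

/-- The linear component `Π p`: the orthogonal projection of `p` to the linear chains. -/
noncomputable def linPart {d n : ℕ} (p : Fin n → Pt d) : Fin n → Pt d :=
  WithLp.ofLp ((linearChains d n).starProjection (WithLp.toLp 2 p))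

open Classical in
/-- The relative distortion `|p|_2 / |Π p|_1` of a chain with `n` points, and `∞` if the linear
component of `p` is constant. -/
noncomputable def distortion {d n : ℕ} (p : Fin n → Pt d) : ℝ≥0∞ :=
  if diff d n (linPart p) ≠ 0 then ENNReal.ofReal (norm2 p / norm1 (linPart p)) else ⊤

namespace Chain

variable {d n : ℕ}

/-- The subchain `[p_i; …; p_{i+n-1}]`, where `0 ≤ i ≤ #P - n`. -/
def sub (P : Chain d n) (i : Fin (P.len - n + 1)) : Fin n → Pt d :=
  fun j => P.pt ⟨(i : ℕ) + (j : ℕ), by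
    have h := P.le_len
    omega⟩

/-- The relative distortion of a chain with at least `n` points: the maximum of the relative
distortions of its subchains with `n` points. -/
noncomputable def kappa (P : Chain d n) : ℝ≥0∞ := ⨆ i, distortion (P.sub i)

end Chain

/-- A similarity `p ↦ ϱ Q p + s` with `ϱ > 0` and `Q` orthogonal. -/
structure Similarity (d : ℕ) where
  /-- The scaling factor. -/
  scale : ℝ
  scale_pos : 0 < scale
  /-- The orthogonal part. -/
  rot : Pt d ≃ₗᵢ[ℝ] Pt d
  /-- The shift vector. -/
  shift : Pt d

/-- The action of a similarity on points. -/
noncomputable def Similarity.onPt {d : ℕ} (S : Similarity d) (p : Pt d) : Pt d :=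
  S.scale • S.rot p + S.shift

/-- The pointwise action of a similarity on chains. -/
noncomputable def Similarity.onChain {d n : ℕ} (S : Similarity d) (P : Chain d n) : Chain d n where
  len := P.len
  le_len := P.le_len
  pt := fun i => S.onPt (P.pt i)

/-- The first unit vector. -/
noncomputable def e1 (d : ℕ) [NeZero d] : Pt d := EuclideanSpace.single 0 1

/-- The points `[e; 2e; …; Ne]` of the standard linear chain. -/
noncomputable def stdPts (d : ℕ) [NeZero d] (N : ℕ) : Fin N → Pt d :=
  fun j => ((j : ℝ) + 1) • e1 d

/-- The standard linear chain with `n` points. -/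
noncomputable def stdChain (d : ℕ) [NeZero d] (n : ℕ) : Chain d n where
  len := n
  le_len := le_rfl
  pt := stdPts d n

/-- `g` is `C^{1,ν}` in some neighbourhood of `x`. -/
def IsC1HolderNear {E F : Type*} [NormedAddCommGroup E] [NormedSpace ℝ E]
    [NormedAddCommGroup F] [NormedSpace ℝ F] (ν : ℝ≥0) (g : E → F) (x : E) : Prop :=
  ∃ U : Set E, IsOpen U ∧ x ∈ U ∧ ContDiffOn ℝ 1 g U ∧
    ∃ C : ℝ≥0, HolderOnWith C ν (fderiv ℝ g) U

/-- `G` is a GLUE-scheme (geometric, local, uniform, equilinear) with spread `n = 2 m + 1`.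
Locality is part of `uniform`: the points with indices `2 i` and `2 i + 1` of `G P` are functions
of `p_i, …, p_{i+m}` only. -/
structure IsGLUE {d : ℕ} [NeZero d] (m : ℕ)
    (G : Chain d (2 * m + 1) → Chain d (2 * m + 1)) : Prop where
  one_le : 1 ≤ m
  /-- `#G(P) = 2 #P - n + 1 = 2 #P - 2 m`. -/
  len_eq : ∀ P, (G P).len = 2 * P.len - 2 * m
  /-- `G` commutes with all similarities. -/
  geometric : ∀ (S : Similarity d) (P : Chain d (2 * m + 1)),
    G (S.onChain P) = S.onChain (G P)
  /-- All points are computed by the same two rules `g 0`, `g 1`, which are of class `C^{1,ν}`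
  near the standard linear chain with `m + 1` points. -/
  uniform : ∃ g : Fin 2 → (Fin (m + 1) → Pt d) → Pt d,
    (∀ (P : Chain d (2 * m + 1)) (i : ℕ) (hi : i < P.len - m) (l : Fin 2),
      (G P).pt ⟨2 * i + (l : ℕ), by rw [len_eq P]; omega⟩ =
        g l (fun j => P.pt ⟨i + (j : ℕ), by omega⟩)) ∧
    ∃ ν : ℝ≥0, 0 < ν ∧ ∀ l : Fin 2, IsC1HolderNear ν (g l) (stdPts d (m + 1))
  /-- The image of the standard linear chain `𝐞` with `n` points is `(𝐄_{n+1} + (m + τ) e) / 2`. -/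
  equilinear : ∃ τ : ℝ, 0 ≤ τ ∧ τ < 1 ∧
    ∀ j : Fin (G (stdChain d (2 * m + 1))).len,
      (G (stdChain d (2 * m + 1))).pt j =
        (1 / 2 : ℝ) • (((j : ℝ) + 1) • e1 d + ((m : ℝ) + τ) • e1 d)

section Straightening

variable {d n : ℕ}

/-- `P` is straightened by `G`: the relative distortions of the iterates `G^ℓ(P)` tend to `0`
(in particular, only finitely many of them are infinite). -/
def Straightened (G : Chain d n → Chain d n) (P : Chain d n) : Prop :=
  Tendsto (fun ℓ : ℕ => (G^[ℓ] P).kappa) atTop (𝓝 0)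

/-- `P` is strongly straightened by `G`: the relative distortions of the iterates are finite and
summable from some index on. -/
def StronglyStraightened (G : Chain d n → Chain d n) (P : Chain d n) : Prop :=
  ∃ ℓ₀ : ℕ, ∑' ℓ : ℕ, (G^[ℓ₀ + ℓ] P).kappa < ⊤

/-- `P` is straightened by `G` at rate `α`: the sequence `2^{ℓ α} κ(G^ℓ(P))` is finite and bounded
from some index on. -/
def StraightenedAtRate (α : ℝ) (G : Chain d n → Chain d n) (P : Chain d n) : Prop :=
  ∃ ℓ₀ : ℕ, ∃ C : ℝ≥0, ∀ ℓ : ℕ, ℓ₀ ≤ ℓ →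
    (2 : ℝ≥0∞) ^ ((ℓ : ℝ) * α) * (G^[ℓ] P).kappa ≤ (C : ℝ≥0∞)

end Straightening

section LimitCurves

variable {d n : ℕ}

/-- The length `N - n + 1` of the natural parameter interval for a chain with `N` points. -/
def Chain.width (P : Chain d n) : ℝ := (P.len : ℝ) - (n : ℝ) + 1

/-- The open parameter interval `I = (0, N - n + 1)`. -/
def Chain.I (P : Chain d n) : Set ℝ := Ioo 0 P.width

/-- The closed parameter interval `I_z = [z, N - n + 1 - z]`. -/
def Chain.Icl (P : Chain d n) (z : ℝ) : Set ℝ := Icc z (P.width - z)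

/-- `Φ` is a limit curve of `G` at `P`: it is continuous and, for all `z > 0`, the supremum of
`‖Φ(2^{-ℓ} i) - p^ℓ_i‖` over all indices `i` with `2^{-ℓ} i ∈ I_z` tends to `0` as `ℓ → ∞`. -/
def IsLimitCurve (G : Chain d n → Chain d n) (P : Chain d n) (Φ : ℝ → Pt d) : Prop :=
  Continuous Φ ∧ ∀ z : ℝ, 0 < z → ∀ ε : ℝ, 0 < ε → ∀ᶠ ℓ : ℕ in atTop,
    ∀ i : Fin (G^[ℓ] P).len, ((i : ℕ) : ℝ) / 2 ^ ℓ ∈ P.Icl z →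
      ‖Φ (((i : ℕ) : ℝ) / 2 ^ ℓ) - (G^[ℓ] P).pt i‖ ≤ ε

/-- `G` is convergent at `P`. -/
def ConvergentAt (G : Chain d n → Chain d n) (P : Chain d n) : Prop :=
  ∃ Φ : ℝ → Pt d, IsLimitCurve G P Φ

/-- `G` is `C^k` at `P`: it is convergent at `P` and its limit curve (which is unique on the open
interval `I`) is of class `C^k` on `I`. -/
def CkAt (k : ℕ) (G : Chain d n → Chain d n) (P : Chain d n) : Prop :=
  ConvergentAt G P ∧ ∀ Φ : ℝ → Pt d, IsLimitCurve G P Φ → ContDiffOn ℝ k Φ P.I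

/-- `G` is `C^{k,α}` at `P`: it is convergent at `P` and its limit curve is of class `C^k` on `I`
with, for some `h₀ > 0` and all `z > 0`,
`sup_{0 < h ≤ h₀} h^{-α} max_{t ∈ I_{z+h/2}} ‖∂^k Φ(t + h/2) - ∂^k Φ(t - h/2)‖ < ∞`. -/
def CkHolderAt (k : ℕ) (α : ℝ) (G : Chain d n → Chain d n) (P : Chain d n) : Prop :=
  ConvergentAt G P ∧ ∀ Φ : ℝ → Pt d, IsLimitCurve G P Φ →
    ContDiffOn ℝ k Φ P.I ∧
    ∃ h₀ : ℝ, 0 < h₀ ∧ ∀ z : ℝ, 0 < z → ∃ C : ℝ, ∀ h : ℝ, 0 < h → h ≤ h₀ →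
      ∀ t ∈ P.Icl (z + h / 2),
        h ^ (-α) * ‖iteratedDeriv k Φ (t + h / 2) - iteratedDeriv k Φ (t - h / 2)‖ ≤ C

end LimitCurves

end Glue

/-! Near a linear chain a GLUE-scheme is almost linear interpolation. By equilinearity and
similarity invariance, the rules send the linear chain $b+ja$ to $b+\mu a$ and $b+(\mu+1/2)a$, where
$\mu=(m+\tau-1)/2$. Differentiability at the standard chain turns a relative deviation $\eta$ from
linearity into an error $O(\eta\|a\|)$. Small distortion makes neighbouring differences nearly equal
(`nearLinear_of_kappa_le`). One step therefore replaces a difference $a$ by differences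
$a/2+O(\kappa_\ell\|a\|)$ and moves points by $O(\|a\|)$ (`exists_step_bound`).

If $\kappa_\ell\to0$, the differences eventually shrink at least by the factor $3/4$ per step, so
the displacements are summable and the points converge uniformly. If $\sum\kappa_\ell<\infty$, the
scaled differences $2^\ell\Delta\mathbf P^\ell$ stay bounded, being controlled by
$\prod(1+O(\kappa_\ell))$, and they vary by only $O(\kappa_\ell)$ under refinement and between
neighbours. They converge uniformly to a continuous $\psi$, which is the derivative of the limit
curve (`hasDerivAt_of_dyadic_limits`). At scale $2^{-\ell}$ the modulus of continuity of $\psi$ is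
bounded by a multiple of the tail $\sum_{k\ge\ell}\kappa_k$, hence by $O(2^{-\ell\alpha})$ for
straightening at rate $\alpha$. Both limits are instances of `exists_dyadic_limit`. -/

namespace Glue

/-! ### Limits of data on dyadic grids -/

section Dyadic

variable {E : Type*} [NormedAddCommGroup E]

/-- For fixed `t`, the floor index passes from each level to one of its two children, so a bound on
refinement steps controls the whole sequence over `t`. -/
theorem floor_two_pow_succ_mul (ℓ : ℕ) (t : ℝ) :
    ∃ l < 2, ⌊(2 : ℝ) ^ (ℓ + 1) * t⌋₊ = 2 * ⌊(2 : ℝ) ^ ℓ * t⌋₊ + l := by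
  refine ⟨⌊(2 : ℝ) ^ (ℓ + 1) * t⌋₊ % 2, Nat.mod_lt _ two_pos, ?_⟩
  have h : ⌊(2 : ℝ) ^ ℓ * t⌋₊ = ⌊(2 : ℝ) ^ (ℓ + 1) * t⌋₊ / 2 := by
    rw [← Nat.floor_div_ofNat]
    congr 1
    rw [pow_succ]
    change _ = _ / (2 : ℝ)
    ring
  omega

theorem floor_two_pow_mul_le {w : ℕ} {t : ℝ} (ht : t ≤ w) (ℓ : ℕ) :
    ⌊(2 : ℝ) ^ ℓ * t⌋₊ ≤ 2 ^ ℓ * w := by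
  apply Nat.floor_le_of_le
  push_cast
  gcongr

/-- Data on dyadic grids whose changes under refinement and whose jumps are summable converge
uniformly to a continuous function. -/
theorem exists_dyadic_limit [CompleteSpace E] (w ℓ₀ : ℕ) (x : ℕ → ℕ → E) (β : ℕ → ℝ)
    (hβ : Summable β) (hβ0 : ∀ ℓ, 0 ≤ β ℓ)
    (hstep : ∀ ℓ ≥ ℓ₀, ∀ i, i ≤ 2 ^ ℓ * w → ∀ l < 2, 2 * i + l ≤ 2 ^ (ℓ + 1) * w →
      ‖x (ℓ + 1) (2 * i + l) - x ℓ i‖ ≤ β ℓ)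
    (hjump : ∀ ℓ ≥ ℓ₀, ∀ i, i + 1 ≤ 2 ^ ℓ * w → ‖x ℓ (i + 1) - x ℓ i‖ ≤ β ℓ) :
    ∃ f : ℝ → E, Continuous f ∧
      (∀ ℓ ≥ ℓ₀, ∀ t ∈ Icc (0 : ℝ) w,
        ‖f t - x ℓ ⌊(2 : ℝ) ^ ℓ * t⌋₊‖ ≤ ∑' k, β (ℓ + k)) ∧
      (∀ ℓ ≥ ℓ₀, ∀ s t, |s - t| ≤ 1 / 2 ^ ℓ → ‖f s - f t‖ ≤ 3 * ∑' k, β (ℓ + k)) := by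
  have hw : (0 : ℝ) ≤ w := Nat.cast_nonneg w
  -- Parameters are clamped to $[0,w]$, so that the limit is defined and continuous on all of
  -- $\mathbb R$.
  set c : ℝ → ℝ := fun t => (projIcc (0 : ℝ) w hw t : ℝ) with hc
  have hcm (t) : c t ∈ Icc (0 : ℝ) w := (projIcc (0 : ℝ) w hw t).2
  have hcid (t) (ht : t ∈ Icc (0 : ℝ) w) : c t = t := by
    simp only [hc, projIcc_of_mem hw ht]
  have hcl (s t) : |c s - c t| ≤ |s - t| := abs_projIcc_sub_projIcc hw
  set y : ℝ → ℕ → E := fun t k => x (ℓ₀ + k) ⌊(2 : ℝ) ^ (ℓ₀ + k) * c t⌋₊ with hy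
  have hyd (t) (k) : dist (y t k) (y t k.succ) ≤ β (ℓ₀ + k) := by
    obtain ⟨l, hl, h⟩ := floor_two_pow_succ_mul (ℓ₀ + k) (c t)
    have h1 := floor_two_pow_mul_le (hcm t).2 (ℓ₀ + k)
    have h2 := floor_two_pow_mul_le (hcm t).2 (ℓ₀ + k + 1)
    rw [dist_comm, dist_eq_norm]
    simp only [hy, Nat.succ_eq_add_one, ← add_assoc]
    rw [h] at h2 ⊢
    exact hstep _ (by omega) _ h1 _ hl h2
  have hβs : Summable fun k => β (ℓ₀ + k) := by
    simpa only [add_comm] using (summable_nat_add_iff ℓ₀).2 hβ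
  have hlim (t) : ∃ a, Tendsto (y t) atTop (𝓝 a) :=
    cauchySeq_tendsto_of_complete (cauchySeq_of_dist_le_of_summable _ (hyd t) hβs)
  choose f hf using hlim
  have happ (ℓ) (hℓ : ℓ ≥ ℓ₀) (t) :
      ‖f t - x ℓ ⌊(2 : ℝ) ^ ℓ * c t⌋₊‖ ≤ ∑' k, β (ℓ + k) := by
    obtain ⟨k, rfl⟩ := Nat.exists_eq_add_of_le hℓ
    have := dist_le_tsum_of_dist_le_of_tendsto _ (hyd t) hβs (hf t) k
    rw [dist_comm, dist_eq_norm] at this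
    simpa only [add_assoc] using this
  have htail (ℓ) : β ℓ ≤ ∑' k, β (ℓ + k) := by
    have hs : Summable fun k => β (ℓ + k) := by
      simpa only [add_comm] using (summable_nat_add_iff ℓ).2 hβ
    simpa using hs.le_tsum 0 fun k _ => hβ0 _
  have hadj (ℓ) (hℓ : ℓ ≥ ℓ₀) (s t : ℝ) (hst : s ≤ t) (h : t - s ≤ 1 / 2 ^ ℓ) (ht : t ≤ w) :
      ‖x ℓ ⌊(2 : ℝ) ^ ℓ * t⌋₊ - x ℓ ⌊(2 : ℝ) ^ ℓ * s⌋₊‖ ≤ β ℓ := by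
    have hp : (0 : ℝ) < 2 ^ ℓ := by positivity
    have h1 : ⌊(2 : ℝ) ^ ℓ * s⌋₊ ≤ ⌊(2 : ℝ) ^ ℓ * t⌋₊ := by gcongr
    have h2 : ⌊(2 : ℝ) ^ ℓ * t⌋₊ ≤ ⌊(2 : ℝ) ^ ℓ * s⌋₊ + 1 := by
      have h3 : (2 : ℝ) ^ ℓ * t ≤ 2 ^ ℓ * s + 1 := by
        rw [le_div_iff₀ hp] at h
        linarith
      refine (Nat.floor_le_floor h3).trans ?_
      rcases le_or_gt 0 ((2 : ℝ) ^ ℓ * s) with h0 | h0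
      · rw [Nat.floor_add_one h0]
      · exact Nat.floor_le_of_le (by push_cast; linarith [Nat.cast_nonneg (α := ℝ) ⌊(2 : ℝ) ^ ℓ * s⌋₊])
    have h4 := floor_two_pow_mul_le ht ℓ
    rcases h1.eq_or_lt with h5 | h5
    · rw [h5]; simpa using hβ0 ℓ
    · have h6 : ⌊(2 : ℝ) ^ ℓ * t⌋₊ = ⌊(2 : ℝ) ^ ℓ * s⌋₊ + 1 := by omega
      rw [h6] at h4 ⊢
      exact hjump ℓ hℓ _ h4
  have hmod (ℓ) (hℓ : ℓ ≥ ℓ₀) (s t) (h : |s - t| ≤ 1 / 2 ^ ℓ) :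
      ‖f s - f t‖ ≤ 3 * ∑' k, β (ℓ + k) := by
    wlog hst : c s ≤ c t generalizing s t
    · rw [norm_sub_rev]
      exact this t s (by rwa [abs_sub_comm]) (not_le.1 hst).le
    have h1 := hadj ℓ hℓ (c s) (c t) hst
      ((le_abs_self _).trans (by rw [abs_sub_comm]; exact (hcl s t).trans h)) (hcm t).2
    have h2 := happ ℓ hℓ s
    have h3 := happ ℓ hℓ t
    rw [norm_sub_rev] at h1
    rw [norm_sub_rev] at h3
    set X := x ℓ ⌊(2 : ℝ) ^ ℓ * c s⌋₊
    set Y := x ℓ ⌊(2 : ℝ) ^ ℓ * c t⌋₊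
    -- Two approximation errors and one jump, each at most the tail of `β`.
    have h4 : f s - f t = (f s - X) + (X - Y) + (Y - f t) := by abel
    rw [h4]
    linarith [norm_add₃_le (a := f s - X) (b := X - Y) (c := Y - f t), htail ℓ]
  refine ⟨f, ?_, fun ℓ hℓ t ht => by simpa only [hcid t ht] using happ ℓ hℓ t, hmod⟩
  refine Metric.continuous_iff.2 fun t ε hε => ?_
  have ht0 : Tendsto (fun ℓ => 3 * ∑' k, β (ℓ + k)) atTop (𝓝 0) := by
    simpa [add_comm] using (tendsto_sum_nat_add β).const_mul 3
  obtain ⟨ℓ, hℓ, hℓ'⟩ := ((ht0.eventually_lt_const hε).and (eventually_ge_atTop ℓ₀)).exists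
  refine ⟨1 / 2 ^ ℓ, by positivity, fun s hs => ?_⟩
  rw [dist_eq_norm]
  rw [Real.dist_eq] at hs
  exact (hmod ℓ hℓ' s t hs.le).trans_lt hℓ

theorem tendsto_floor_two_pow_mul_div {s : ℝ} (hs : 0 ≤ s) :
    Tendsto (fun ℓ : ℕ => (⌊(2 : ℝ) ^ ℓ * s⌋₊ : ℝ) / 2 ^ ℓ) atTop (𝓝 s) := by
  have h := (tendsto_nat_floor_mul_div_atTop hs).comp
    (tendsto_pow_atTop_atTop_of_one_lt (one_lt_two (α := ℝ)))
  refine h.congr fun ℓ => ?_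
  simp [mul_comm]

variable [NormedSpace ℝ E]

/-- If points on dyadic grids converge to `Φ` and their difference quotients to `ψ`, then `Φ` has
the derivative `ψ`. -/
theorem hasDerivAt_of_dyadic_limits (w : ℕ) (x : ℕ → ℕ → E) (Φ ψ : ℝ → E)
    (hΦ : Continuous Φ) (hψ : Continuous ψ)
    (hx : ∀ z : ℝ, 0 < z → ∀ ε : ℝ, 0 < ε → ∀ᶠ ℓ : ℕ in atTop, ∀ i : ℕ,
      (i : ℝ) / 2 ^ ℓ ∈ Icc z (w - z) → ‖Φ ((i : ℝ) / 2 ^ ℓ) - x ℓ i‖ ≤ ε)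
    (hD : ∀ ε : ℝ, 0 < ε → ∀ᶠ ℓ : ℕ in atTop, ∀ t ∈ Icc (0 : ℝ) w,
      ‖ψ t - (2 : ℝ) ^ ℓ • (x ℓ (⌊(2 : ℝ) ^ ℓ * t⌋₊ + 1) - x ℓ ⌊(2 : ℝ) ^ ℓ * t⌋₊)‖ ≤ ε)
    {t : ℝ} (ht : t ∈ Ioo (0 : ℝ) w) : HasDerivAt Φ (ψ t) t := by
  have hpt (s) (hs : s ∈ Ioo (0 : ℝ) w) :
      Tendsto (fun ℓ => x ℓ ⌊(2 : ℝ) ^ ℓ * s⌋₊) atTop (𝓝 (Φ s)) := by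
    have h1 := tendsto_floor_two_pow_mul_div hs.1.le
    obtain ⟨z, hz, hzs⟩ : ∃ z : ℝ, 0 < z ∧ s ∈ Ioo z (w - z) := by
      refine ⟨min s (w - s) / 2, by simp [hs.1, hs.2], ?_, ?_⟩
      · linarith [min_le_left s (w - s), hs.1]
      · linarith [min_le_right s (w - s), hs.2]
    have h2 : Tendsto (fun ℓ : ℕ => Φ ((⌊(2 : ℝ) ^ ℓ * s⌋₊ : ℝ) / 2 ^ ℓ) - x ℓ ⌊(2 : ℝ) ^ ℓ * s⌋₊)
        atTop (𝓝 0) := by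
      refine Metric.tendsto_nhds.2 fun ε hε => ?_
      filter_upwards [hx z hz (ε / 2) (by positivity),
        h1.eventually (Ioo_mem_nhds hzs.1 hzs.2)] with ℓ h3 h4
      rw [dist_zero_right]
      linarith [h3 _ ⟨h4.1.le, h4.2.le⟩]
    simpa using ((hΦ.tendsto s).comp h1).sub h2
  -- The estimate is shown between grid points approaching `s` and `s'`, then passed to the limit.
  have key (ε : ℝ) (hε : 0 < ε) : ∃ δ > 0, Ioo (t - δ) (t + δ) ⊆ Ioo (0 : ℝ) w ∧
      ∀ s ∈ Ioo (t - δ) (t + δ), ∀ s' ∈ Ioo (t - δ) (t + δ), s ≤ s' →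
        ‖Φ s' - Φ s - (s' - s) • ψ t‖ ≤ ε * (s' - s) := by
    have h1 : ∀ᶠ s in 𝓝 t, s ∈ Ioo (0 : ℝ) w ∧ ‖ψ s - ψ t‖ < ε / 2 :=
      Filter.Eventually.and (Ioo_mem_nhds ht.1 ht.2) (by
        have := Metric.tendsto_nhds.1 (hψ.tendsto t) (ε / 2) (by positivity)
        simpa only [dist_eq_norm] using this)
    obtain ⟨δ, hδ, h2⟩ := Metric.eventually_nhds_iff_ball.1 h1
    rw [Real.ball_eq_Ioo] at h2
    refine ⟨δ, hδ, fun s hs => (h2 s hs).1, fun s hs s' hs' hss => ?_⟩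
    have hs0 := (h2 s hs).1
    have hs0' := (h2 s' hs').1
    have hi := tendsto_floor_two_pow_mul_div hs0.1.le
    have hj := tendsto_floor_two_pow_mul_div hs0'.1.le
    have hL := ((hpt s' hs0').sub (hpt s hs0)).sub ((hj.sub hi).smul_const (ψ t))
    refine le_of_tendsto_of_tendsto hL.norm ((hj.sub hi).const_mul ε) ?_
    filter_upwards [hD (ε / 2) (by positivity), hi.eventually (Ioo_mem_nhds hs.1 hs.2)] with ℓ h3 h4
    have hp : (0 : ℝ) < 2 ^ ℓ := by positivity
    set i := ⌊(2 : ℝ) ^ ℓ * s⌋₊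
    have hij : i ≤ ⌊(2 : ℝ) ^ ℓ * s'⌋₊ := Nat.floor_le_floor (by gcongr)
    have hjs : ((⌊(2 : ℝ) ^ ℓ * s'⌋₊ : ℕ) : ℝ) / 2 ^ ℓ ≤ s' := by
      rw [div_le_iff₀ hp, mul_comm s']
      exact Nat.floor_le (by nlinarith [hs0'.1])
    -- Telescoping: each grid increment differs from $2^{-\ell}\psi(t)$ by at most
    -- $2^{-\ell}\varepsilon$, half of it from the difference quotients and half from the continuity
    -- of `ψ`.
    have main (k : ℕ) (hk : ((i + k : ℕ) : ℝ) / 2 ^ ℓ ≤ s') :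
        ‖x ℓ (i + k) - x ℓ i - (((i + k : ℕ) : ℝ) / 2 ^ ℓ - (i : ℝ) / 2 ^ ℓ) • ψ t‖ ≤
          ε * (((i + k : ℕ) : ℝ) / 2 ^ ℓ - (i : ℝ) / 2 ^ ℓ) := by
      induction k with
      | zero => simp
      | succ k ih =>
        have hk' : ((i + k : ℕ) : ℝ) / 2 ^ ℓ ≤ s' :=
          le_trans (by gcongr; omega) hk
        have hm : ((i + k : ℕ) : ℝ) / 2 ^ ℓ ∈ Ioo (t - δ) (t + δ) :=
          ⟨h4.1.trans_le (by gcongr; omega), hk'.trans_lt hs'.2⟩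
        have h5 := h3 _ ⟨(h2 _ hm).1.1.le, (h2 _ hm).1.2.le⟩
        rw [mul_div_cancel₀ _ hp.ne', Nat.floor_natCast] at h5
        have h6 := (h2 _ hm).2
        set τ := ((i + k : ℕ) : ℝ) / 2 ^ ℓ with hτ
        have hτ' : ((i + (k + 1) : ℕ) : ℝ) / 2 ^ ℓ = τ + 1 / 2 ^ ℓ := by
          rw [hτ]; push_cast; ring
        have h7 : ‖(x ℓ (i + k + 1) - x ℓ (i + k)) - (1 / 2 ^ ℓ : ℝ) • ψ t‖ ≤ ε * (1 / 2 ^ ℓ) := by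
          have h8 : (x ℓ (i + k + 1) - x ℓ (i + k)) - (1 / 2 ^ ℓ : ℝ) • ψ t =
              (1 / 2 ^ ℓ : ℝ) • ((ψ τ - ψ t) -
                (ψ τ - (2 : ℝ) ^ ℓ • (x ℓ (i + k + 1) - x ℓ (i + k)))) := by
            rw [sub_sub_sub_cancel_left, smul_sub, smul_smul, one_div_mul_cancel hp.ne', one_smul]
          rw [h8, norm_smul, Real.norm_of_nonneg (by positivity), mul_comm]
          gcongr
          refine (norm_sub_le _ _).trans ?_
          linarith
        have h9 : x ℓ (i + (k + 1)) - x ℓ i - (τ + 1 / 2 ^ ℓ - (i : ℝ) / 2 ^ ℓ) • ψ t =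
            (x ℓ (i + k) - x ℓ i - (τ - (i : ℝ) / 2 ^ ℓ) • ψ t) +
              ((x ℓ (i + k + 1) - x ℓ (i + k)) - (1 / 2 ^ ℓ : ℝ) • ψ t) := by
          rw [← add_assoc]; module
        rw [hτ', h9]
        refine (norm_add_le _ _).trans ?_
        linarith [ih hk']
    obtain ⟨k, hk⟩ := Nat.exists_eq_add_of_le hij
    rw [hk] at hjs ⊢
    exact main k hjs
  rw [hasDerivAt_iff_isLittleO, Asymptotics.isLittleO_iff]
  intro ε hε
  obtain ⟨δ, hδ, -, h⟩ := key ε hε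
  filter_upwards [Ioo_mem_nhds (sub_lt_self t hδ) (lt_add_of_pos_right t hδ)] with s hs
  have htm : t ∈ Ioo (t - δ) (t + δ) := ⟨sub_lt_self t hδ, lt_add_of_pos_right t hδ⟩
  rcases le_total t s with hts | hts
  · rw [Real.norm_of_nonneg (sub_nonneg.2 hts)]
    exact h t htm s hs hts
  · have h1 := h s hs t htm hts
    rw [Real.norm_of_nonpos (sub_nonpos.2 hts), neg_sub]
    have h2 : Φ s - Φ t - (s - t) • ψ t = -(Φ t - Φ s - (t - s) • ψ t) := by
      rw [← neg_sub s t, neg_smul]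
      abel
    rwa [h2, norm_neg]

end Dyadic

/-- The sequence `x`, of which the first `N` terms matter, has nonvanishing differences, and its
second differences are bounded by `r` times the first differences. -/
def NearLinear {E : Type*} [NormedAddCommGroup E] (r : ℝ) (x : ℕ → E) (N : ℕ) : Prop :=
  ∀ k, k + 1 < N → x (k + 1) - x k ≠ 0 ∧
    (k + 2 < N → ‖x (k + 2) - x (k + 1) - (x (k + 1) - x k)‖ ≤ r * ‖x (k + 1) - x k‖)

/-! ### Sequences with small relative second differences -/

section NearLinear

variable {E : Type*} [NormedAddCommGroup E]

/-- As `r ≤ 1`, differences at most double from one index to the next; passing from `j` to `j + 1`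
thus adds at most $2^j r$ to the relative error. -/
theorem NearLinear.norm_diff_sub_le {r : ℝ} {x : ℕ → E} {N : ℕ} (h : NearLinear r x N)
    (hr0 : 0 ≤ r) (hr1 : r ≤ 1) (i j : ℕ) (hj : i + j + 1 < N) :
    ‖x (i + j + 1) - x (i + j) - (x (i + 1) - x i)‖ ≤ (2 ^ j - 1) * r * ‖x (i + 1) - x i‖ := by
  induction j with
  | zero => simp
  | succ j ih =>
    have ih := ih (by omega)
    have h1 := (h (i + j) (by omega)).2 (by omega)
    set a := x (i + 1) - x i
    set b := x (i + j + 1) - x (i + j)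
    have h2 : ‖b‖ ≤ 2 ^ j * ‖a‖ := by
      have h3 : b = (b - a) + a := by abel
      have h4 : (1 : ℝ) ≤ 2 ^ j := one_le_pow₀ (by norm_num)
      have h5 : (2 ^ j - 1) * r * ‖a‖ ≤ (2 ^ j - 1) * 1 * ‖a‖ := by
        gcongr
      rw [h3]
      refine (norm_add_le _ _).trans ?_
      linarith
    have h6 : x (i + (j + 1) + 1) - x (i + (j + 1)) - a = (x (i + j + 2) - x (i + j + 1) - b) + (b - a) := by
      simp only [add_assoc, Nat.reduceAdd]
      abel
    rw [h6]
    refine (norm_add_le _ _).trans ?_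
    have h7 : r * ‖b‖ ≤ r * (2 ^ j * ‖a‖) := by gcongr
    rw [pow_succ]
    linarith

/-- The errors $(2^k-1)r$ of the differences, $k<j$, sum to at most $2^j r$. -/
theorem NearLinear.norm_sub_linear_le [NormedSpace ℝ E] {r : ℝ} {x : ℕ → E} {N : ℕ} (h : NearLinear r x N)
    (hr0 : 0 ≤ r) (hr1 : r ≤ 1) (i j : ℕ) (hj : i + j < N) :
    ‖x (i + j) - (x i + (j : ℝ) • (x (i + 1) - x i))‖ ≤ 2 ^ j * r * ‖x (i + 1) - x i‖ := by
  induction j with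
  | zero => simpa using by positivity
  | succ j ih =>
    have ih := ih (by omega)
    have h1 := h.norm_diff_sub_le hr0 hr1 i j (by omega)
    set a := x (i + 1) - x i
    have h2 : x (i + (j + 1)) - (x i + ((j + 1 : ℕ) : ℝ) • a) =
        (x (i + j + 1) - x (i + j) - a) + (x (i + j) - (x i + (j : ℝ) • a)) := by
      push_cast
      rw [← add_assoc]
      module
    rw [h2]
    refine (norm_add_le _ _).trans ?_
    have : 0 ≤ r * ‖a‖ := by positivity
    rw [pow_succ]
    linarith

end NearLinear

/-! ### The refinement rules near linear chains -/

section Rules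

variable {d : ℕ}

/-- The sequence of points of a chain, continued by `0`. -/
noncomputable def Chain.seq {d n : ℕ} (P : Chain d n) (i : ℕ) : Pt d :=
  if h : i < P.len then P.pt ⟨i, h⟩ else 0

theorem Chain.seq_of_lt {d n : ℕ} (P : Chain d n) {i : ℕ} (h : i < P.len) :
    P.seq i = P.pt ⟨i, h⟩ := dif_pos h

theorem Similarity.onPt_sub_onPt (S : Similarity d) (p q : Pt d) :
    ‖S.onPt p - S.onPt q‖ = S.scale * ‖p - q‖ := by
  simp only [Similarity.onPt, add_sub_add_right_eq_sub]
  rw [← smul_sub, ← map_sub, norm_smul, Real.norm_of_nonneg S.scale_pos.le,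
    LinearIsometryEquiv.norm_map]

theorem Similarity.exists_onPt_eq (S : Similarity d) (p : Pt d) : ∃ q, S.onPt q = p := by
  refine ⟨S.rot.symm (S.scale⁻¹ • (p - S.shift)), ?_⟩
  simp only [Similarity.onPt, LinearIsometryEquiv.apply_symm_apply]
  rw [smul_inv_smul₀ S.scale_pos.ne', sub_add_cancel]

theorem pt_congr {n : ℕ} {P Q : Chain d n} (h : P = Q) (i : ℕ) (hP : i < P.len) (hQ : i < Q.len) :
    P.pt ⟨i, hP⟩ = Q.pt ⟨i, hQ⟩ := by
  subst h
  rfl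

variable [NeZero d] {m : ℕ}

/-- A similarity maps the standard linear chain to the linear chain `b + t • a`. -/
theorem exists_similarity {a : Pt d} (ha : a ≠ 0) (b : Pt d) :
    ∃ S : Similarity d, S.scale = ‖a‖ ∧ ∀ t : ℝ, S.onPt ((t + 1) • e1 d) = b + t • a := by
  have hn : ‖a‖ ≠ 0 := norm_ne_zero_iff.2 ha
  have he : ‖e1 d‖ = ‖(‖a‖⁻¹ : ℝ) • a‖ := by
    rw [norm_smul, norm_inv, norm_norm, inv_mul_cancel₀ hn]
    simp [e1]
  -- The reflection exchanges $e$ and $a/\|a\|$; the shift is `b - a` because the standard chain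
  -- starts at $e$, not at the origin.
  refine ⟨⟨‖a‖, by positivity, (ℝ ∙ (e1 d - (‖a‖⁻¹ : ℝ) • a))ᗮ.reflection, b - a⟩, rfl,
    fun t => ?_⟩
  simp only [Similarity.onPt, map_smul]
  rw [Submodule.reflection_sub he, smul_smul, smul_smul]
  have : ‖a‖ * (t + 1) * ‖a‖⁻¹ = t + 1 := by field_simp
  rw [this]
  module

variable {G : Chain d (2 * m + 1) → Chain d (2 * m + 1)}

/-- Invariance descends from the scheme to the rules: any $m+1$ points begin some chain of $n$
points, and the first two points of its image depend on them alone. -/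
theorem exists_rules (hG : IsGLUE m G) :
    ∃ g : Fin 2 → (Fin (m + 1) → Pt d) → Pt d, ∃ τ : ℝ, 0 ≤ τ ∧ τ < 1 ∧
      (∀ (P : Chain d (2 * m + 1)) (i : ℕ), i + m < P.len → ∀ l : Fin 2,
        (G P).seq (2 * i + l) = g l fun j => P.seq (i + j)) ∧
      (∀ (S : Similarity d) (l : Fin 2) (x : Fin (m + 1) → Pt d),
        g l (fun j => S.onPt (x j)) = S.onPt (g l x)) ∧
      (∀ l : Fin 2, DifferentiableAt ℝ (g l) (stdPts d (m + 1))) ∧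
      ∀ l : Fin 2, g l (stdPts d (m + 1)) = (((m + τ - 1 + (l : ℕ)) / 2 : ℝ) + 1) • e1 d := by
  obtain ⟨g, hg, ν, -, hν⟩ := hG.uniform
  obtain ⟨τ, h0, h1, hτ⟩ := hG.equilinear
  have hm := hG.one_le
  have hzero (P : Chain d (2 * m + 1)) (l : Fin 2) : (l : ℕ) < (G P).len := by
    rw [hG.len_eq]
    have := P.le_len
    omega
  have hg0 (P : Chain d (2 * m + 1)) (l : Fin 2) :
      (G P).pt ⟨l, hzero P l⟩ = g l fun j => P.pt ⟨j, by have := P.le_len; omega⟩ := by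
    have h := hg P 0 (by have := P.le_len; omega) l
    simpa only [mul_zero, zero_add] using h
  refine ⟨g, τ, h0, h1, fun P i hi l => ?_, fun S l x => ?_, fun l => ?_, fun l => ?_⟩
  · have hi' : i < P.len - m := by omega
    rw [Chain.seq_of_lt _ (by rw [hG.len_eq]; omega), hg P i hi' l]
    congr 1
    funext j
    rw [Chain.seq_of_lt]
  · let Q : Chain d (2 * m + 1) :=
      ⟨2 * m + 1, le_rfl, fun j => if h : (j : ℕ) < m + 1 then x ⟨j, h⟩ else 0⟩
    have hx : (fun j : Fin (m + 1) => Q.pt ⟨j, by simp only [Q]; omega⟩) = x := by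
      funext j
      exact dif_pos j.2
    have hQ := hg0 Q l
    have hSQ := hg0 (S.onChain Q) l
    rw [pt_congr (hG.geometric S Q) l _ (hzero Q l)] at hSQ
    rw [hx] at hQ
    have hx' : (fun j : Fin (m + 1) => (S.onChain Q).pt ⟨j, by simp only [Q, Similarity.onChain]; omega⟩)
        = fun j => S.onPt (x j) := by
      funext j
      exact congrArg S.onPt (dif_pos j.2)
    rw [hx'] at hSQ
    rw [← hSQ, ← hQ]
    rfl
  · obtain ⟨U, hU, hxU, hc, -⟩ := hν l
    exact (hc.contDiffAt (hU.mem_nhds hxU)).differentiableAt (by simp)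
  · have h := hg0 (stdChain d (2 * m + 1)) l
    rw [hτ] at h
    have hx : (fun j : Fin (m + 1) => (stdChain d (2 * m + 1)).pt
        ⟨j, by simp only [stdChain]; omega⟩) = stdPts d (m + 1) := by
      funext j
      simp [stdChain, stdPts]
    rw [hx] at h
    rw [← h]
    module

/-- A similarity of scale $\|a\|$ moves the window to within `η` of the standard chain, where the
derivative of the rules gives an error linear in `η`. -/
theorem exists_rules_bound (hG : IsGLUE m G) :
    ∃ μ : ℝ, 0 ≤ μ ∧ μ ≤ m ∧ ∃ K : ℝ, 0 ≤ K ∧ ∃ δ : ℝ, 0 < δ ∧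
      ∀ (P : Chain d (2 * m + 1)) (i : ℕ), i + m < P.len → ∀ l < 2,
        ∀ (a : Pt d) (η : ℝ), a ≠ 0 → 0 ≤ η → η ≤ δ →
          (∀ j ≤ m, ‖P.seq (i + j) - (P.seq i + (j : ℝ) • a)‖ ≤ η * ‖a‖) →
          ‖(G P).seq (2 * i + l) - (P.seq i + (μ + (l : ℝ) / 2) • a)‖ ≤ K * η * ‖a‖ := by
  obtain ⟨g, τ, h0, h1, hg, hS, hd, he⟩ := exists_rules hG
  have hm : (1 : ℝ) ≤ m := by exact_mod_cast hG.one_le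
  have hK (l : Fin 2) : ∃ K : ℝ, 0 ≤ K ∧ ∃ δ : ℝ, 0 < δ ∧ ∀ x, ‖x - stdPts d (m + 1)‖ ≤ δ →
      ‖g l x - g l (stdPts d (m + 1))‖ ≤ K * ‖x - stdPts d (m + 1)‖ := by
    obtain ⟨K, hK, hb⟩ := (hd l).hasFDerivAt.isBigO_sub.exists_nonneg
    obtain ⟨δ, hδ, hb⟩ := Metric.eventually_nhds_iff_ball.1 hb.bound
    refine ⟨K, hK, δ / 2, by positivity, fun x hx => hb x ?_⟩
    rw [mem_ball_iff_norm]
    linarith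
  choose K hK0 δ hδ hK using hK
  -- The bounds on this `μ` come from `1 ≤ m` and `0 ≤ τ < 1`.
  refine ⟨(m + τ - 1) / 2, by linarith, by linarith, max (K 0) (K 1),
    (hK0 0).trans (le_max_left _ _), min (δ 0) (δ 1), lt_min (hδ 0) (hδ 1), ?_⟩
  intro P i hi l hl a η ha hη hηδ hP
  obtain ⟨S, hSs, hSe⟩ := exists_similarity ha (P.seq i)
  choose y hy using fun j : Fin (m + 1) => S.exists_onPt_eq (P.seq (i + j))
  have hpos : 0 < ‖a‖ := norm_pos_iff.2 ha
  have hyE : ‖y - stdPts d (m + 1)‖ ≤ η := by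
    refine (pi_norm_le_iff_of_nonneg hη).2 fun j => ?_
    have h2 := hP j (by omega)
    rw [← hy, ← hSe, S.onPt_sub_onPt, hSs, mul_comm] at h2
    exact le_of_mul_le_mul_right h2 hpos
  have hgl := hg P i hi ⟨l, hl⟩
  simp only [← hy] at hgl
  rw [hS] at hgl
  have hb : ‖g ⟨l, hl⟩ y - g ⟨l, hl⟩ (stdPts d (m + 1))‖ ≤ max (K 0) (K 1) * η := by
    have hKl : K ⟨l, hl⟩ ≤ max (K 0) (K 1) ∧ min (δ 0) (δ 1) ≤ δ ⟨l, hl⟩ := by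
      interval_cases l
      · exact ⟨le_max_left _ _, min_le_left _ _⟩
      · exact ⟨le_max_right _ _, min_le_right _ _⟩
    refine (hK ⟨l, hl⟩ y (hyE.trans (hηδ.trans hKl.2))).trans ?_
    gcongr
    · exact (hK0 0).trans (le_max_left _ _)
    · exact hKl.1
  have harg : ((m : ℝ) + τ - 1) / 2 + (l : ℝ) / 2 = (m + τ - 1 + l) / 2 := by ring
  rw [harg, ← hSe, hgl, S.onPt_sub_onPt, hSs, mul_comm]
  rw [he] at hb
  gcongr

/-- One step of a GLUE-scheme halves the differences of a nearly linear chain, up to a small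
relative error. -/
theorem exists_step_bound (hG : IsGLUE m G) :
    ∃ C : ℝ, 0 ≤ C ∧ ∃ δ : ℝ, 0 < δ ∧ ∀ (P : Chain d (2 * m + 1)) (r : ℝ), 0 ≤ r → r ≤ δ →
      NearLinear r P.seq P.len → ∀ i, i + m < P.len → ∀ l < 2,
        ‖(G P).seq (2 * i + l) - P.seq i‖ ≤ C * ‖P.seq (i + 1) - P.seq i‖ ∧
        (2 * i + l + 1 < (G P).len →
          ‖(G P).seq (2 * i + l + 1) - (G P).seq (2 * i + l) -
            (1 / 2 : ℝ) • (P.seq (i + 1) - P.seq i)‖ ≤ C * r * ‖P.seq (i + 1) - P.seq i‖) := by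
  obtain ⟨μ, hμ0, hμm, K, hK, δ, hδ, hb⟩ := exists_rules_bound hG
  have hm := hG.one_le
  set B : ℝ := 2 ^ m with hB
  have hB1 : 1 ≤ B := one_le_pow₀ (by norm_num)
  -- An odd difference straddles two windows: their errors cost `K * B * r` and twice that, as the
  -- next difference may be twice as long; the change of window adds `μ * r ≤ m * r`. The bound `δ /
  -- B` keeps the deviation `B * r` in the range of the rule estimate.
  refine ⟨m + 1 + 3 * K * B, by positivity, min 1 (δ / B), by positivity, ?_⟩
  intro P r hr0 hrδ hP i hi l hl
  have hr1 : r ≤ 1 := hrδ.trans (min_le_left _ _)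
  have hrB : B * r ≤ δ := by
    have := hrδ.trans (min_le_right _ _)
    rw [le_div_iff₀ (by positivity)] at this
    linarith
  have happ (i : ℕ) (hi : i + m < P.len) (l : ℕ) (hl : l < 2) :
      ‖(G P).seq (2 * i + l) - (P.seq i + (μ + (l : ℝ) / 2) • (P.seq (i + 1) - P.seq i))‖ ≤
        K * (B * r) * ‖P.seq (i + 1) - P.seq i‖ := by
    refine hb P i hi l hl _ (B * r) (hP i (by omega)).1 (by positivity) hrB fun j hj => ?_
    refine (hP.norm_sub_linear_le hr0 hr1 i j (by omega)).trans ?_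
    rw [hB]
    gcongr
    norm_num
  set a := P.seq (i + 1) - P.seq i with ha
  have ha0 : 0 ≤ ‖a‖ := norm_nonneg a
  have hKB : 0 ≤ K * B * ‖a‖ := by positivity
  have hKBr : 0 ≤ K * B * r * ‖a‖ := by positivity
  have hl' : (l : ℝ) ≤ 1 := by exact_mod_cast Nat.lt_succ_iff.1 hl
  have hl0 : (0 : ℝ) ≤ l := Nat.cast_nonneg l
  have hm0 : (0 : ℝ) ≤ m := Nat.cast_nonneg m
  refine ⟨?_, fun hlen => ?_⟩
  · have h1 : (G P).seq (2 * i + l) - P.seq i =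
        ((G P).seq (2 * i + l) - (P.seq i + (μ + (l : ℝ) / 2) • a)) + (μ + (l : ℝ) / 2) • a := by
      module
    rw [h1]
    refine (norm_add_le _ _).trans ?_
    rw [norm_smul, Real.norm_of_nonneg (by positivity)]
    have h2 := happ i hi l hl
    have h3 : K * (B * r) * ‖a‖ ≤ K * (B * 1) * ‖a‖ := by gcongr
    have h4 : (μ + (l : ℝ) / 2) * ‖a‖ ≤ (m + 1) * ‖a‖ := by
      gcongr
      linarith
    linarith
  · have hmr : 0 ≤ m * r * ‖a‖ := by positivity
    have hr : 0 ≤ r * ‖a‖ := by positivity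
    -- For `l = 0` both points use window `i` and their models differ by exactly $a/2$. For `l = 1`
    -- the second point uses window `i + 1`, and the models differ by $a/2+\mu(a'-a)$.
    obtain rfl | rfl : l = 0 ∨ l = 1 := by omega
    · have h1 := happ i hi 0 (by omega)
      have h2 := happ i hi 1 (by omega)
      have h3 : (G P).seq (2 * i + 0 + 1) - (G P).seq (2 * i + 0) - (1 / 2 : ℝ) • a =
          ((G P).seq (2 * i + 1) - (P.seq i + (μ + ((1 : ℕ) : ℝ) / 2) • a)) -
          ((G P).seq (2 * i + 0) - (P.seq i + (μ + ((0 : ℕ) : ℝ) / 2) • a)) := by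
        push_cast
        rw [add_zero]
        module
      rw [h3]
      refine (norm_sub_le _ _).trans ?_
      linarith
    · rw [hG.len_eq] at hlen
      have h1 := happ i hi 1 (by omega)
      have h2 := happ (i + 1) (by omega) 0 (by omega)
      have h4 := (hP i (by omega)).2 (by omega)
      rw [← ha] at h4
      rw [show i + 1 + 1 = i + 2 from rfl] at h2
      set a' := P.seq (i + 2) - P.seq (i + 1) with ha'
      have h5 : ‖a'‖ ≤ 2 * ‖a‖ := by
        have h6 : a' = (a' - a) + a := by abel
        have h7 : r * ‖a‖ ≤ 1 * ‖a‖ := by gcongr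
        rw [h6]
        refine (norm_add_le _ _).trans ?_
        linarith
      have h8 : K * (B * r) * ‖a'‖ ≤ K * (B * r) * (2 * ‖a‖) := by gcongr
      have h3 : (G P).seq (2 * i + 1 + 1) - (G P).seq (2 * i + 1) - (1 / 2 : ℝ) • a =
          ((G P).seq (2 * (i + 1) + 0) - (P.seq (i + 1) + (μ + ((0 : ℕ) : ℝ) / 2) • a')) -
          ((G P).seq (2 * i + 1) - (P.seq i + (μ + ((1 : ℕ) : ℝ) / 2) • a)) +
          μ • (a' - a) := by
        have h9 : P.seq (i + 1) = P.seq i + a := by rw [ha]; abel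
        push_cast
        rw [h9, show 2 * (i + 1) + 0 = 2 * i + 1 + 1 by ring]
        module
      rw [h3]
      refine (norm_add_le _ _).trans ?_
      rw [norm_smul, Real.norm_of_nonneg hμ0]
      have h10 : μ * ‖a' - a‖ ≤ m * (r * ‖a‖) := by gcongr
      have h11 := norm_sub_le
        ((G P).seq (2 * (i + 1) + 0) - (P.seq (i + 1) + (μ + ((0 : ℕ) : ℝ) / 2) • a'))
        ((G P).seq (2 * i + 1) - (P.seq i + (μ + ((1 : ℕ) : ℝ) / 2) • a))
      linarith

end Rules

/-! ### From relative distortion to near linearity -/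

section Distortion

variable {d n : ℕ}

/-- The projection fixes `q` and does not increase the Euclidean norm; comparing that norm with the
maximum costs $\sqrt n\le n$. -/
theorem norm_linPart_sub_le (p q : Fin n → Pt d) (hq : diff d (n - 1) (diff d n q) = 0) {η : ℝ}
    (hη : 0 ≤ η) (h : ∀ i, ‖p i - q i‖ ≤ η) (i : Fin n) : ‖linPart p i - q i‖ ≤ n * η := by
  set v := WithLp.toLp 2 p
  set u := WithLp.toLp 2 q
  have hu : (linearChains d n).starProjection u = u :=
    Submodule.starProjection_eq_self_iff.2 (LinearMap.mem_ker.2 hq)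
  have h1 : ‖v - u‖ ≤ n * η := by
    refine le_of_sq_le_sq ?_ (by positivity)
    rw [PiLp.norm_sq_eq_of_L2]
    have h2 : ∀ i ∈ (Finset.univ : Finset (Fin n)), ‖(v - u) i‖ ^ 2 ≤ η ^ 2 := fun i _ => by
      gcongr
      exact h i
    refine (Finset.sum_le_card_nsmul _ _ _ h2).trans ?_
    rw [Finset.card_univ, Fintype.card_fin, nsmul_eq_mul, mul_pow]
    gcongr
    exact_mod_cast Nat.le_self_pow two_ne_zero n
  have h3 : linPart p i - q i = ((linearChains d n).starProjection (v - u)) i := by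
    rw [map_sub, hu]
    rfl
  rw [h3]
  exact (PiLp.norm_apply_le _ i).trans
    (((linearChains d n).norm_starProjection_apply_le _).trans h1)

theorem norm_second_diff_le_norm2 (y : ℕ → Pt d) {i : ℕ} (hi : i + 2 < n) :
    ‖y (i + 2) - y (i + 1) - (y (i + 1) - y i)‖ ≤ norm2 fun j : Fin n => y j :=
  norm_le_pi_norm (diff d (n - 1) (diff d n fun j : Fin n => y j)) ⟨i, by omega⟩

theorem norm_diff_sub_le_norm2 (y : ℕ → Pt d) (i : ℕ) (hi : i + 1 < n) :
    ‖y (i + 1) - y i - (y 1 - y 0)‖ ≤ i * norm2 fun j : Fin n => y j := by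
  induction i with
  | zero => simp
  | succ i ih =>
    have h1 := norm_second_diff_le_norm2 y hi
    have h2 : y (i + 1 + 1) - y (i + 1) - (y 1 - y 0) =
        (y (i + 2) - y (i + 1) - (y (i + 1) - y i)) + (y (i + 1) - y i - (y 1 - y 0)) := by
      rw [add_assoc]; abel
    rw [h2]
    refine (norm_add_le _ _).trans ?_
    push_cast
    linarith [ih (by omega)]

theorem norm_sub_linear_le_norm2 (y : ℕ → Pt d) (i : ℕ) (hi : i < n) :
    ‖y i - (y 0 + (i : ℝ) • (y 1 - y 0))‖ ≤ n * i * norm2 fun j : Fin n => y j := by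
  induction i with
  | zero => simp
  | succ i ih =>
    have h1 := norm_diff_sub_le_norm2 y i hi
    set s := norm2 fun j : Fin n => y j
    have hs : 0 ≤ s := norm_nonneg _
    have h2 : y (i + 1) - (y 0 + ((i + 1 : ℕ) : ℝ) • (y 1 - y 0)) =
        (y (i + 1) - y i - (y 1 - y 0)) + (y i - (y 0 + (i : ℝ) • (y 1 - y 0))) := by
      push_cast
      module
    rw [h2]
    refine (norm_add_le _ _).trans ?_
    have h3 : i * s ≤ n * s := by gcongr; omega
    push_cast
    linarith [ih (by omega)]

/-- Replaces $|\Pi p|_1$ by the first difference. Comparison with the linear chain through the first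
two points gives $|\Pi p|_1\le\|a\|+2n^3|p|_2\le\|a\|+2n^3k|\Pi p|_1$, and the last term is absorbed
on the left. -/
theorem norm2_le_of_distortion_le (y : ℕ → Pt d) {k : ℝ} (hk0 : 0 ≤ k) (hk : 4 * n ^ 3 * k ≤ 1)
    (h : distortion (fun j : Fin n => y j) ≤ ENNReal.ofReal k) :
    y 1 - y 0 ≠ 0 ∧ norm2 (fun j : Fin n => y j) ≤ 2 * k * ‖y 1 - y 0‖ := by
  set p : Fin n → Pt d := fun j => y j with hp
  set a := y 1 - y 0 with ha
  set s := norm2 p with hs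
  have hs0 : 0 ≤ s := norm_nonneg _
  unfold distortion at h
  split_ifs at h with h0
  swap
  · simp at h
  have hL : 0 < norm1 (linPart p) := norm_pos_iff.2 h0
  rw [ENNReal.ofReal_le_ofReal_iff hk0, div_le_iff₀ hL] at h
  set q : Fin n → Pt d := fun j => y 0 + ((j : ℕ) : ℝ) • a with hq
  have hqd (i : Fin (n - 1)) : diff d n q i = a := by
    simp only [diff, hq, LinearMap.coe_mk, AddHom.coe_mk]
    push_cast
    module
  have hqd2 : diff d (n - 1) (diff d n q) = 0 := by
    funext i
    change diff d n q _ - diff d n q _ = 0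
    rw [hqd, hqd, sub_self]
  have hpq (i : Fin n) : ‖p i - q i‖ ≤ n * n * s := by
    refine (norm_sub_linear_le_norm2 y i i.2).trans ?_
    gcongr
    exact i.2.le
  have hlin := norm_linPart_sub_le p q hqd2 (by positivity) hpq
  have hnorm : norm1 (linPart p) ≤ ‖a‖ + 2 * (n * (n * n * s)) := by
    refine (pi_norm_le_iff_of_nonneg (by positivity)).2 fun i => ?_
    have h1 : diff d n (linPart p) i = diff d n q i +
        ((linPart p ⟨(i : ℕ) + 1, by omega⟩ - q ⟨(i : ℕ) + 1, by omega⟩) -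
          (linPart p ⟨(i : ℕ), by omega⟩ - q ⟨(i : ℕ), by omega⟩)) := by
      simp only [diff, LinearMap.coe_mk, AddHom.coe_mk]
      abel
    rw [h1, hqd]
    refine (norm_add_le _ _).trans ?_
    gcongr
    refine (norm_sub_le _ _).trans ?_
    linarith [hlin ⟨(i : ℕ) + 1, by omega⟩, hlin ⟨(i : ℕ), by omega⟩]
  have h2 : (n : ℝ) ^ 3 * s ≤ n ^ 3 * (k * norm1 (linPart p)) := by gcongr
  have h3 : 4 * n ^ 3 * k * norm1 (linPart p) ≤ 1 * norm1 (linPart p) := by gcongr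
  have h4 : norm1 (linPart p) ≤ 2 * ‖a‖ := by nlinarith
  refine ⟨fun h5 => ?_, ?_⟩
  · rw [h5, norm_zero] at h4
    linarith
  · have : k * norm1 (linPart p) ≤ k * (2 * ‖a‖) := by gcongr
    linarith

theorem Chain.sub_eq_seq (P : Chain d n) (i : Fin (P.len - n + 1)) :
    P.sub i = fun j : Fin n => P.seq (i + j) := by
  funext j
  rw [Chain.seq_of_lt]
  rfl

/-- In a window every difference is at least half as long as the first, which doubles the constant
`2 * k` to `4 * k`. Indices too close to the end to start a window lie in the last one. -/
theorem nearLinear_of_kappa_le (hn : 3 ≤ n) (P : Chain d n) {k : ℝ} (hk0 : 0 ≤ k)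
    (hk : 4 * n ^ 3 * k ≤ 1) (h : P.kappa ≤ ENNReal.ofReal k) :
    NearLinear (4 * k) P.seq P.len := by
  have hN := P.le_len
  have hn1 : (1 : ℝ) ≤ n := by exact_mod_cast (by omega : 1 ≤ n)
  have window (i : ℕ) (hi : i + n ≤ P.len) (j : ℕ) (hj : j + 1 < n) :
      P.seq (i + j + 1) - P.seq (i + j) ≠ 0 ∧
      (j + 2 < n → ‖P.seq (i + j + 2) - P.seq (i + j + 1) -
        (P.seq (i + j + 1) - P.seq (i + j))‖ ≤
          4 * k * ‖P.seq (i + j + 1) - P.seq (i + j)‖) := by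
    have h1 : distortion (P.sub ⟨i, by omega⟩) ≤ ENNReal.ofReal k :=
      (le_iSup (fun i => distortion (P.sub i)) _).trans h
    rw [Chain.sub_eq_seq] at h1
    obtain ⟨h2, h3⟩ := norm2_le_of_distortion_le (fun j => P.seq (i + j)) hk0 hk h1
    have h4 := norm_diff_sub_le_norm2 (n := n) (fun j => P.seq (i + j)) j hj
    simp only [← add_assoc] at h2 h3 h4
    set s := norm2 fun j : Fin n => P.seq (i + j)
    have hs : 0 ≤ s := norm_nonneg _
    set a := P.seq (i + 1) - P.seq (i + 0)
    set b := P.seq (i + j + 1) - P.seq (i + j)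
    have ha : 0 < ‖a‖ := norm_pos_iff.2 h2
    have h5 : j * s ≤ ‖a‖ / 2 := by
      have h6 : (j : ℝ) * s ≤ n * (2 * k * ‖a‖) := by gcongr; omega
      have h7 : (n : ℝ) ≤ n ^ 3 := le_self_pow₀ hn1 (by norm_num)
      have h8 : (n : ℝ) * (4 * k * ‖a‖) ≤ n ^ 3 * (4 * k * ‖a‖) := by gcongr
      have h9 : 4 * n ^ 3 * k * ‖a‖ ≤ 1 * ‖a‖ := by gcongr
      linarith
    have h10 : ‖a‖ / 2 ≤ ‖b‖ := by
      have := norm_sub_norm_le a b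
      rw [norm_sub_rev a b] at this
      linarith
    refine ⟨fun hb => ?_, fun hj2 => ?_⟩
    · rw [hb, norm_zero] at h10
      linarith
    · have h11 := norm_second_diff_le_norm2 (n := n) (fun j => P.seq (i + j)) hj2
      simp only [← add_assoc] at h11
      refine h11.trans (h3.trans ?_)
      have : 2 * k * ‖a‖ ≤ 2 * k * (2 * ‖b‖) := by gcongr; linarith
      linarith
  intro c hc
  rcases le_or_gt (c + n) P.len with hcn | hcn
  · have h1 := window c hcn 0 (by omega)
    simp only [add_zero] at h1
    exact ⟨h1.1, fun _ => h1.2 (by omega)⟩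
  · have h1 := window (P.len - n) (by omega) (c - (P.len - n)) (by omega)
    rw [show P.len - n + (c - (P.len - n)) = c by omega] at h1
    exact ⟨h1.1, fun _ => h1.2 (by omega)⟩

end Distortion

/-! ### Convergence of points and of scaled differences -/

section Convergence

variable {d m : ℕ} {G : Chain d (2 * m + 1) → Chain d (2 * m + 1)}

theorem width_eq (P : Chain d (2 * m + 1)) : P.width = ((P.len - 2 * m : ℕ) : ℝ) := by
  have := P.le_len
  rw [Nat.cast_sub (by omega), Chain.width]
  push_cast
  ring

theorem StronglyStraightened.straightened {P : Chain d (2 * m + 1)}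
    (h : StronglyStraightened G P) : Straightened G P := by
  obtain ⟨ℓ₀, h⟩ := h
  have h1 := ENNReal.tendsto_atTop_zero_of_tsum_ne_top h.ne
  simp only [add_comm ℓ₀] at h1
  exact (tendsto_add_atTop_iff_nat (f := fun ℓ => (G^[ℓ] P).kappa) ℓ₀).1 h1

theorem StronglyStraightened.summable {P : Chain d (2 * m + 1)}
    (h : StronglyStraightened G P) : Summable fun ℓ => (G^[ℓ] P).kappa.toReal := by
  obtain ⟨ℓ₀, h⟩ := h
  have h1 := ENNReal.summable_toReal h.ne
  simp only [add_comm ℓ₀] at h1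
  exact (summable_nat_add_iff (f := fun ℓ => (G^[ℓ] P).kappa.toReal) ℓ₀).1 h1

variable [NeZero d]

/-- The length $2m$ is a fixed point of $N\mapsto2N-2m$, so the excess over it doubles. -/
theorem len_iterate (hG : IsGLUE m G) (P : Chain d (2 * m + 1)) (ℓ : ℕ) :
    (G^[ℓ] P).len = 2 ^ ℓ * (P.len - 2 * m) + 2 * m := by
  have := P.le_len
  induction ℓ with
  | zero => simp only [Function.iterate_zero, id]; omega
  | succ ℓ ih =>
    rw [Function.iterate_succ_apply', hG.len_eq, ih, pow_succ, mul_comm (2 ^ ℓ) 2, mul_assoc]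
    omega

theorem eventually_step_bound (hG : IsGLUE m G) (P : Chain d (2 * m + 1)) (ρ : ℕ → ℝ)
    (hρ0 : ∀ ℓ, 0 ≤ ρ ℓ) (hρ : Tendsto ρ atTop (𝓝 0))
    (hP : ∀ᶠ ℓ in atTop, NearLinear (ρ ℓ) (G^[ℓ] P).seq (G^[ℓ] P).len) :
    ∃ C : ℝ, 0 ≤ C ∧ ∀ᶠ ℓ in atTop, C * ρ ℓ ≤ 1 / 4 ∧
      ∀ i, i < 2 ^ ℓ * (P.len - 2 * m) + m → ∀ l < 2,
        ‖(G^[ℓ + 1] P).seq (2 * i + l) - (G^[ℓ] P).seq i‖ ≤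
          C * ‖(G^[ℓ] P).seq (i + 1) - (G^[ℓ] P).seq i‖ ∧
        (2 * i + l + 1 < 2 ^ (ℓ + 1) * (P.len - 2 * m) + 2 * m →
          ‖(G^[ℓ + 1] P).seq (2 * i + l + 1) - (G^[ℓ + 1] P).seq (2 * i + l) -
            (1 / 2 : ℝ) • ((G^[ℓ] P).seq (i + 1) - (G^[ℓ] P).seq i)‖ ≤
              C * ρ ℓ * ‖(G^[ℓ] P).seq (i + 1) - (G^[ℓ] P).seq i‖) := by
  obtain ⟨C, hC, δ, hδ, h⟩ := exists_step_bound hG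
  refine ⟨C, hC, ?_⟩
  have h1 : Tendsto (fun ℓ => C * ρ ℓ) atTop (𝓝 0) := by simpa using hρ.const_mul C
  filter_upwards [hP, hρ.eventually_le_const hδ,
    h1.eventually_le_const (show (0 : ℝ) < 1 / 4 by norm_num)] with ℓ h2 h3 h4
  refine ⟨h4, fun i hi l hl => ?_⟩
  have h5 := h (G^[ℓ] P) (ρ ℓ) (hρ0 ℓ) h3 h2 i (by rw [len_iterate hG]; omega) l hl
  rw [← Function.iterate_succ_apply' G, len_iterate hG P (ℓ + 1)] at h5
  exact h5

/-- Differences that are halved by refinement up to relative errors `c ℓ` grow at most like a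
supersolution of the corresponding recursion. -/
theorem exists_diff_bound {E : Type*} [NormedAddCommGroup E] [NormedSpace ℝ E] {m w : ℕ}
    (hm : 1 ≤ m) (x : ℕ → ℕ → E) (c a : ℕ → ℝ) (ha : ∀ ℓ, 0 < a ℓ) (ℓ₀ : ℕ)
    (hc : ∀ ℓ ≥ ℓ₀, 0 ≤ c ℓ)
    (hrec : ∀ ℓ ≥ ℓ₀, (1 / 2 + c ℓ) * a ℓ ≤ a (ℓ + 1))
    (hx : ∀ ℓ ≥ ℓ₀, ∀ i, i < 2 ^ ℓ * w + m → ∀ l < 2,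
      2 * i + l + 1 < 2 ^ (ℓ + 1) * w + 2 * m →
        ‖x (ℓ + 1) (2 * i + l + 1) - x (ℓ + 1) (2 * i + l) -
          (1 / 2 : ℝ) • (x ℓ (i + 1) - x ℓ i)‖ ≤ c ℓ * ‖x ℓ (i + 1) - x ℓ i‖) :
    ∃ A : ℝ, 0 ≤ A ∧ ∀ ℓ ≥ ℓ₀, ∀ i, i + 1 < 2 ^ ℓ * w + 2 * m →
      ‖x ℓ (i + 1) - x ℓ i‖ ≤ A * a ℓ := by
  -- The sum dominates every single difference on the initial level.
  set T := ∑ i ∈ Finset.range (2 ^ ℓ₀ * w + 2 * m), ‖x ℓ₀ (i + 1) - x ℓ₀ i‖ with hT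
  have hT0 : 0 ≤ T := Finset.sum_nonneg fun _ _ => norm_nonneg _
  have hA : 0 ≤ T / a ℓ₀ := div_nonneg hT0 (ha _).le
  refine ⟨T / a ℓ₀, hA, fun ℓ hℓ => ?_⟩
  induction ℓ, hℓ using Nat.le_induction with
  | base =>
    intro i hi
    rw [div_mul_cancel₀ _ (ha _).ne']
    exact Finset.single_le_sum (f := fun i => ‖x ℓ₀ (i + 1) - x ℓ₀ i‖)
      (fun _ _ => norm_nonneg _) (Finset.mem_range.2 (by omega))
  | succ ℓ hℓ ih =>
    intro j hj
    have hp : 2 ^ (ℓ + 1) * w = 2 * (2 ^ ℓ * w) := by ring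
    obtain ⟨i, l, hl, rfl⟩ : ∃ i l, l < 2 ∧ j = 2 * i + l :=
      ⟨j / 2, j % 2, Nat.mod_lt _ two_pos, by omega⟩
    have h1 := hx ℓ hℓ i (by omega) l hl hj
    -- Here `1 ≤ m` is needed: `i < 2 ^ ℓ * w + m` must imply `i + 1 < 2 ^ ℓ * w + 2 * m`.
    have h2 := ih i (by omega)
    set u := x ℓ (i + 1) - x ℓ i
    set v := x (ℓ + 1) (2 * i + l + 1) - x (ℓ + 1) (2 * i + l)
    have h3 : v = (v - (1 / 2 : ℝ) • u) + (1 / 2 : ℝ) • u := by abel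
    have h4 : ‖v‖ ≤ (1 / 2 + c ℓ) * ‖u‖ := by
      rw [h3]
      refine (norm_add_le _ _).trans ?_
      rw [norm_smul, Real.norm_of_nonneg (by norm_num)]
      linarith
    have h0 : 0 ≤ 1 / 2 + c ℓ := by linarith [hc ℓ hℓ]
    calc ‖v‖ ≤ (1 / 2 + c ℓ) * ‖u‖ := h4
      _ ≤ (1 / 2 + c ℓ) * (T / a ℓ₀ * a ℓ) := by gcongr
      _ = T / a ℓ₀ * ((1 / 2 + c ℓ) * a ℓ) := by ring
      _ ≤ T / a ℓ₀ * a (ℓ + 1) := by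
        gcongr
        exact hrec ℓ hℓ

/-- Once `C * ρ ℓ ≤ 1 / 4`, differences decay like $(3/4)^\ell$, and so do the displacements that
they bound. -/
theorem convergentAt_of_nearLinear (hG : IsGLUE m G) (P : Chain d (2 * m + 1)) (ρ : ℕ → ℝ)
    (hρ0 : ∀ ℓ, 0 ≤ ρ ℓ) (hρ : Tendsto ρ atTop (𝓝 0))
    (hP : ∀ᶠ ℓ in atTop, NearLinear (ρ ℓ) (G^[ℓ] P).seq (G^[ℓ] P).len) : ConvergentAt G P := by
  obtain ⟨C, hC, h⟩ := eventually_step_bound hG P ρ hρ0 hρ hP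
  obtain ⟨ℓ₀, h⟩ := eventually_atTop.1 h
  have hm := hG.one_le
  set w := P.len - 2 * m with hw
  obtain ⟨A, hA, hd⟩ := exists_diff_bound (w := w) hm (fun ℓ => (G^[ℓ] P).seq) (fun ℓ => C * ρ ℓ)
    (fun ℓ => (3 / 4) ^ ℓ) (fun ℓ => by positivity) ℓ₀ (fun ℓ _ => mul_nonneg hC (hρ0 ℓ))
    (fun ℓ hℓ => by
      rw [pow_succ, mul_comm]
      gcongr
      linarith [(h ℓ hℓ).1])
    (fun ℓ hℓ i hi l hl => ((h ℓ hℓ).2 i hi l hl).2)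
  have hβ : Summable fun ℓ : ℕ => (C + 1) * (A * (3 / 4 : ℝ) ^ ℓ) :=
    ((summable_geometric_of_lt_one (by norm_num) (by norm_num)).mul_left A).mul_left (C + 1)
  have hA' (ℓ : ℕ) : 0 ≤ A * (3 / 4 : ℝ) ^ ℓ := by positivity
  obtain ⟨Φ, hΦ, happ, -⟩ := exists_dyadic_limit w ℓ₀ (fun ℓ => (G^[ℓ] P).seq) _ hβ
    (fun ℓ => by positivity)
    (fun ℓ hℓ i hi l hl _ => by
      refine ((h ℓ hℓ).2 i (by omega) l hl).1.trans ?_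
      have h1 : C * ‖(G^[ℓ] P).seq (i + 1) - (G^[ℓ] P).seq i‖ ≤ C * (A * (3 / 4) ^ ℓ) := by
        gcongr
        exact hd ℓ hℓ i (by omega)
      linarith [hA' ℓ])
    (fun ℓ hℓ i hi => by
      refine (hd ℓ hℓ i (by omega)).trans ?_
      linarith [mul_nonneg hC (hA' ℓ)])
  refine ⟨Φ, hΦ, fun z hz ε hε => ?_⟩
  have ht0 : Tendsto (fun ℓ => ∑' k, (C + 1) * (A * (3 / 4 : ℝ) ^ (ℓ + k))) atTop (𝓝 0) := by
    simpa [add_comm] using tendsto_sum_nat_add fun ℓ : ℕ => (C + 1) * (A * (3 / 4 : ℝ) ^ ℓ)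
  filter_upwards [ht0.eventually_le_const hε, eventually_ge_atTop ℓ₀] with ℓ h1 h2 i hi
  rw [Chain.Icl, width_eq] at hi
  have h3 := happ ℓ h2 _ ⟨hz.le.trans hi.1, hi.2.trans (by linarith)⟩
  rw [mul_div_cancel₀ _ (by positivity), Nat.floor_natCast, Chain.seq_of_lt _ i.2] at h3
  exact h3.trans h1

/-- The dyadic limit theorem is applied to the scaled differences, whose refinement steps and jumps
are of order `ρ ℓ` once they are known to be bounded. -/
theorem exists_derivative (hG : IsGLUE m G) (P : Chain d (2 * m + 1)) (ρ : ℕ → ℝ)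
    (hρ0 : ∀ ℓ, 0 ≤ ρ ℓ) (hρ : Summable ρ)
    (hP : ∀ᶠ ℓ in atTop, NearLinear (ρ ℓ) (G^[ℓ] P).seq (G^[ℓ] P).len) :
    ∃ ψ : ℝ → Pt d, Continuous ψ ∧
      (∃ B : ℝ, 0 ≤ B ∧ ∃ ℓ₀, ∀ ℓ ≥ ℓ₀, ∀ s t, |s - t| ≤ 1 / 2 ^ ℓ →
        ‖ψ s - ψ t‖ ≤ B * ∑' k, ρ (ℓ + k)) ∧
      ∀ Φ, IsLimitCurve G P Φ → ∀ t ∈ P.I, HasDerivAt Φ (ψ t) t := by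
  obtain ⟨C, hC, h⟩ := eventually_step_bound hG P ρ hρ0 hρ.tendsto_atTop_zero hP
  obtain ⟨ℓ₀, h⟩ := eventually_atTop.1 (h.and hP)
  have hm := hG.one_le
  set w := P.len - 2 * m with hw
  -- A discrete Grönwall factor: $1+2C\rho_\ell\le e^{2C\rho_\ell}$, and summability of `ρ` bounds
  -- the product.
  set σ : ℕ → ℝ := fun ℓ => Real.exp (2 * C * ∑ k ∈ Finset.range ℓ, ρ k) with hσ
  obtain ⟨A, hA, hd⟩ := exists_diff_bound (w := w) hm (fun ℓ => (G^[ℓ] P).seq) (fun ℓ => C * ρ ℓ)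
    (fun ℓ => (1 / 2) ^ ℓ * σ ℓ) (fun ℓ => by positivity) ℓ₀ (fun ℓ _ => mul_nonneg hC (hρ0 ℓ))
    (fun ℓ hℓ => by
      have h1 : σ (ℓ + 1) = σ ℓ * Real.exp (2 * C * ρ ℓ) := by
        simp only [hσ]
        rw [← Real.exp_add, Finset.sum_range_succ]
        ring_nf
      have h2 := Real.add_one_le_exp (2 * C * ρ ℓ)
      rw [h1]
      calc (1 / 2 + C * ρ ℓ) * ((1 / 2) ^ ℓ * σ ℓ)
          = (1 / 2) ^ (ℓ + 1) * (σ ℓ * (2 * C * ρ ℓ + 1)) := by ring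
        _ ≤ _ := by gcongr)
    (fun ℓ hℓ i hi l hl => ((h ℓ hℓ).1.2 i hi l hl).2)
  set M := A * Real.exp (2 * C * ∑' k, ρ k) with hM
  have hM0 : 0 ≤ M := by positivity
  have hDM (ℓ) (hℓ : ℓ ≥ ℓ₀) (i) (hi : i + 1 < 2 ^ ℓ * w + 2 * m) :
      (2 : ℝ) ^ ℓ * ‖(G^[ℓ] P).seq (i + 1) - (G^[ℓ] P).seq i‖ ≤ M := by
    have h1 : σ ℓ ≤ Real.exp (2 * C * ∑' k, ρ k) := by
      simp only [hσ]
      gcongr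
      exact hρ.sum_le_tsum _ fun k _ => hρ0 k
    calc (2 : ℝ) ^ ℓ * ‖(G^[ℓ] P).seq (i + 1) - (G^[ℓ] P).seq i‖
        ≤ 2 ^ ℓ * (A * ((1 / 2) ^ ℓ * σ ℓ)) := by gcongr; exact hd ℓ hℓ i hi
      _ = A * σ ℓ := by
        rw [one_div, inv_pow]
        field_simp
      _ ≤ M := by rw [hM]; gcongr
  set D : ℕ → ℕ → Pt d := fun ℓ i => (2 : ℝ) ^ ℓ • ((G^[ℓ] P).seq (i + 1) - (G^[ℓ] P).seq i) with hD
  -- Refinement contributes `2 * C * M * ρ ℓ`, jumps between neighbours `M * ρ ℓ`.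
  have hβ : Summable fun ℓ : ℕ => (2 * C + 1) * M * ρ ℓ := hρ.mul_left _
  have hMρ (ℓ) : 0 ≤ M * ρ ℓ := mul_nonneg hM0 (hρ0 ℓ)
  obtain ⟨ψ, hψ, happ, hmod⟩ := exists_dyadic_limit w ℓ₀ D _ hβ
    (fun ℓ => mul_nonneg (by positivity) (hρ0 ℓ))
    (fun ℓ hℓ i hi l hl hil => by
      have h1 := ((h ℓ hℓ).1.2 i (by omega) l hl).2 (by omega)
      have h2 := hDM ℓ hℓ i (by omega)
      set u := (G^[ℓ] P).seq (i + 1) - (G^[ℓ] P).seq i with hu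
      set v := (G^[ℓ + 1] P).seq (2 * i + l + 1) - (G^[ℓ + 1] P).seq (2 * i + l) with hv
      have h3 : D (ℓ + 1) (2 * i + l) - D ℓ i = (2 : ℝ) ^ (ℓ + 1) • (v - (1 / 2 : ℝ) • u) := by
        change (2 : ℝ) ^ (ℓ + 1) • v - (2 : ℝ) ^ ℓ • u = _
        rw [pow_succ]
        module
      rw [h3, norm_smul, Real.norm_of_nonneg (by positivity)]
      calc (2 : ℝ) ^ (ℓ + 1) * ‖v - (1 / 2 : ℝ) • u‖ ≤ 2 ^ (ℓ + 1) * (C * ρ ℓ * ‖u‖) := by gcongr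
        _ = 2 * C * ρ ℓ * (2 ^ ℓ * ‖u‖) := by ring
        _ ≤ 2 * C * ρ ℓ * M := by
          have := hρ0 ℓ
          gcongr
        _ ≤ _ := by linarith [hMρ ℓ])
    (fun ℓ hℓ i hi => by
      have h1 := ((h ℓ hℓ).2 i (by rw [len_iterate hG, ← hw]; omega)).2
        (by rw [len_iterate hG, ← hw]; omega)
      have h2 := hDM ℓ hℓ i (by omega)
      simp only [hD]
      rw [← smul_sub, norm_smul, Real.norm_of_nonneg (by positivity)]
      set u := (G^[ℓ] P).seq (i + 1) - (G^[ℓ] P).seq i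
      calc _ ≤ (2 : ℝ) ^ ℓ * (ρ ℓ * ‖u‖) := by gcongr
        _ = ρ ℓ * (2 ^ ℓ * ‖u‖) := by ring
        _ ≤ ρ ℓ * M := by
          have := hρ0 ℓ
          gcongr
        _ ≤ _ := by linarith [mul_nonneg hC (hMρ ℓ)])
  refine ⟨ψ, hψ, ⟨3 * ((2 * C + 1) * M), by positivity, ℓ₀, fun ℓ hℓ s t hst => ?_⟩,
    fun Φ hΦ t ht => ?_⟩
  · refine (hmod ℓ hℓ s t hst).trans_eq ?_
    rw [tsum_mul_left]
    ring
  · rw [Chain.I, width_eq] at ht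
    refine hasDerivAt_of_dyadic_limits w (fun ℓ => (G^[ℓ] P).seq) Φ ψ hΦ.1 hψ ?_ ?_ ht
    · intro z hz ε hε
      filter_upwards [hΦ.2 z hz ε hε] with ℓ h1 i hi
      have hp : (0 : ℝ) < 2 ^ ℓ := by positivity
      have h2 : i < (G^[ℓ] P).len := by
        have h3 := hi.2
        rw [div_le_iff₀ hp] at h3
        have h4 : (i : ℝ) ≤ ((2 ^ ℓ * w : ℕ) : ℝ) := by
          push_cast
          nlinarith
        rw [len_iterate hG, ← hw]
        have h5 : i ≤ 2 ^ ℓ * w := by exact_mod_cast h4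
        omega
      rw [Chain.seq_of_lt _ h2]
      refine h1 ⟨i, h2⟩ ?_
      rw [Chain.Icl, width_eq]
      exact hi
    · intro ε hε
      have ht0 : Tendsto (fun ℓ => ∑' k, (2 * C + 1) * M * ρ (ℓ + k)) atTop (𝓝 0) := by
        simpa [add_comm] using tendsto_sum_nat_add fun ℓ : ℕ => (2 * C + 1) * M * ρ ℓ
      filter_upwards [ht0.eventually_le_const hε, eventually_ge_atTop ℓ₀] with ℓ h1 h2 t ht
      exact (happ ℓ h2 t ht).trans h1

/-! ### The three straightening conditions and their consequences -/

theorem eventually_nearLinear (hG : IsGLUE m G) (P : Chain d (2 * m + 1)) (κ : ℕ → ℝ)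
    (hκ0 : ∀ ℓ, 0 ≤ κ ℓ) (hκ : Tendsto κ atTop (𝓝 0))
    (h : ∀ᶠ ℓ in atTop, (G^[ℓ] P).kappa ≤ ENNReal.ofReal (κ ℓ)) :
    ∀ᶠ ℓ in atTop, NearLinear (4 * κ ℓ) (G^[ℓ] P).seq (G^[ℓ] P).len := by
  have hm := hG.one_le
  have h1 : Tendsto (fun ℓ => 4 * ((2 * m + 1 : ℕ) : ℝ) ^ 3 * κ ℓ) atTop (𝓝 0) := by
    simpa using hκ.const_mul (4 * ((2 * m + 1 : ℕ) : ℝ) ^ 3)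
  filter_upwards [h, h1.eventually_le_const one_pos] with ℓ h2 h3
  exact nearLinear_of_kappa_le (by omega) _ (hκ0 ℓ) h3 h2

theorem Straightened.eventually_nearLinear (hG : IsGLUE m G) {P : Chain d (2 * m + 1)}
    (h : Straightened G P) :
    Tendsto (fun ℓ => 4 * (G^[ℓ] P).kappa.toReal) atTop (𝓝 0) ∧ ∀ᶠ ℓ in atTop,
      NearLinear (4 * (G^[ℓ] P).kappa.toReal) (G^[ℓ] P).seq (G^[ℓ] P).len := by
  have h1 : Tendsto (fun ℓ => (G^[ℓ] P).kappa.toReal) atTop (𝓝 0) := by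
    simpa [Function.comp_def] using (ENNReal.tendsto_toReal ENNReal.zero_ne_top).comp h
  refine ⟨by simpa using h1.const_mul 4, Glue.eventually_nearLinear hG P _
    (fun _ => ENNReal.toReal_nonneg) h1 ?_⟩
  filter_upwards [Tendsto.eventually_lt_const ENNReal.zero_lt_top h] with ℓ h2
  rw [ENNReal.ofReal_toReal h2.ne]

theorem Straightened.convergentAt (hG : IsGLUE m G) {P : Chain d (2 * m + 1)}
    (h : Straightened G P) : ConvergentAt G P :=
  convergentAt_of_nearLinear hG P _ (fun _ => by positivity) (h.eventually_nearLinear hG).1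
    (h.eventually_nearLinear hG).2

theorem contDiffOn_one_of_hasDerivAt {E : Type*} [NormedAddCommGroup E] [NormedSpace ℝ E]
    {f f' : ℝ → E} {s : Set ℝ} (hs : IsOpen s) (hf' : Continuous f')
    (h : ∀ t ∈ s, HasDerivAt f (f' t) t) : ContDiffOn ℝ 1 f s := by
  rw [show (1 : WithTop ℕ∞) = 0 + 1 by norm_num, contDiffOn_succ_iff_deriv_of_isOpen hs]
  refine ⟨fun t ht => (h t ht).differentiableAt.differentiableWithinAt, by simp, ?_⟩
  rw [contDiffOn_zero]
  exact hf'.continuousOn.congr fun t ht => (h t ht).deriv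

theorem StronglyStraightened.c1At (hG : IsGLUE m G) {P : Chain d (2 * m + 1)}
    (h : StronglyStraightened G P) : CkAt 1 G P := by
  refine ⟨h.straightened.convergentAt hG, fun Φ hΦ => ?_⟩
  obtain ⟨ψ, hψ, -, hd⟩ := exists_derivative hG P _ (fun _ => by positivity)
    (h.summable.mul_left 4) (h.straightened.eventually_nearLinear hG).2
  exact_mod_cast contDiffOn_one_of_hasDerivAt isOpen_Ioo hψ (hd Φ hΦ)

theorem StraightenedAtRate.c1HolderAt (hG : IsGLUE m G) {P : Chain d (2 * m + 1)} {α : ℝ}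
    (hα : 0 < α) (h : StraightenedAtRate α G P) : CkHolderAt 1 α G P := by
  obtain ⟨ℓ₁, C, hC⟩ := h
  set q : ℝ := 2 ^ (-α) with hq
  have hq0 : 0 < q := by positivity
  have hq1 : q < 1 := Real.rpow_lt_one_of_one_lt_of_neg one_lt_two (neg_neg_of_pos hα)
  have hκ : ∀ ℓ ≥ ℓ₁, (G^[ℓ] P).kappa ≤ ENNReal.ofReal (C * q ^ ℓ) := fun ℓ hℓ => by
    have h1 := hC ℓ hℓ
    have h2 : (2 : ℝ≥0∞) ^ ((ℓ : ℝ) * α) = ENNReal.ofReal ((q ^ ℓ)⁻¹) := by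
      rw [show (2 : ℝ≥0∞) = ENNReal.ofReal 2 by simp, ENNReal.ofReal_rpow_of_pos two_pos]
      congr 1
      rw [hq, ← Real.rpow_natCast, ← Real.rpow_mul two_pos.le, ← Real.rpow_neg two_pos.le]
      congr 1
      ring
    rw [h2, ENNReal.ofReal_inv_of_pos (by positivity), mul_comm, ← div_eq_mul_inv,
      ENNReal.div_le_iff (by simp [hq0]) ENNReal.ofReal_ne_top] at h1
    rwa [ENNReal.ofReal_mul C.coe_nonneg, ENNReal.ofReal_coe_nnreal]
  have hsum : Summable fun ℓ => C * q ^ ℓ :=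
    (summable_geometric_of_lt_one hq0.le hq1).mul_left _
  have hnl := Glue.eventually_nearLinear hG P (fun ℓ => C * q ^ ℓ) (fun ℓ => by positivity)
    hsum.tendsto_atTop_zero (eventually_atTop.2 ⟨ℓ₁, hκ⟩)
  have hsum4 := hsum.mul_left 4
  refine ⟨convergentAt_of_nearLinear hG P _ (fun ℓ => by positivity) hsum4.tendsto_atTop_zero hnl,
    fun Φ hΦ => ?_⟩
  obtain ⟨ψ, hψ, ⟨B, hB, ℓ₀, hmod⟩, hd⟩ :=
    exists_derivative hG P _ (fun ℓ => by positivity) hsum4 hnl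
  -- The choice $h_0=2^{-\ell_0}$ ensures that only levels with a modulus bound occur below.
  refine ⟨by exact_mod_cast contDiffOn_one_of_hasDerivAt isOpen_Ioo hψ (hd Φ hΦ),
    (1 / 2) ^ ℓ₀, by positivity, fun z hz => ?_⟩
  set T := ∑' k, q ^ k
  have hT : 0 ≤ T := tsum_nonneg fun k => by positivity
  refine ⟨B * (4 * C * T) * q⁻¹, fun k hk0 hk t ht => ?_⟩
  have hmem (s : ℝ) (hs : |s - t| ≤ k / 2) : s ∈ P.I := by
    rw [abs_le] at hs
    exact ⟨by linarith [ht.1], by linarith [ht.2]⟩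
  have hp := hmem (t + k / 2) (by rw [add_sub_cancel_left, abs_of_pos (by positivity)])
  have hm := hmem (t - k / 2) (by
    rw [sub_sub_cancel_left, abs_neg, abs_of_pos (by positivity)])
  rw [iteratedDeriv_one, (hd Φ hΦ _ hp).deriv, (hd Φ hΦ _ hm).deriv]
  -- The level matching the step size: $2^{-(\ell+1)}<k\le2^{-\ell}$. The gap between the two powers
  -- costs the factor $q^{-1}$ in the final constant.
  obtain ⟨ℓ, h1, h2⟩ := exists_nat_pow_near_of_lt_one hk0
    (hk.trans (pow_le_one₀ (by norm_num) (by norm_num))) (by norm_num : (0 : ℝ) < 1 / 2)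
    (by norm_num)
  have hℓ : ℓ ≥ ℓ₀ := by
    have := (pow_lt_pow_iff_right_of_lt_one₀ (by norm_num : (0 : ℝ) < 1 / 2) (by norm_num)).1
      (h1.trans_le hk)
    omega
  have h3 := hmod ℓ hℓ (t + k / 2) (t - k / 2) (by
    rw [show t + k / 2 - (t - k / 2) = k by ring, abs_of_pos hk0]
    simpa using h2)
  have h4 : ∑' j, 4 * (C * q ^ (ℓ + j)) = 4 * C * T * q ^ ℓ := by
    simp only [pow_add, tsum_mul_left]
    ring
  rw [h4] at h3
  have h5 : k ^ (-α) ≤ (q ^ (ℓ + 1))⁻¹ := by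
    refine (Real.rpow_le_rpow_of_nonpos (by positivity) h1.le (by linarith)).trans_eq ?_
    rw [← Real.rpow_natCast, ← Real.rpow_mul (by norm_num), hq, ← Real.rpow_natCast,
      ← Real.rpow_mul two_pos.le, ← Real.rpow_neg two_pos.le, one_div,
      Real.inv_rpow two_pos.le, ← Real.rpow_neg two_pos.le]
    congr 1
    ring
  calc k ^ (-α) * ‖ψ (t + k / 2) - ψ (t - k / 2)‖
      ≤ (q ^ (ℓ + 1))⁻¹ * (B * (4 * C * T * q ^ ℓ)) := by gcongr
    _ = B * (4 * C * T) * q⁻¹ := by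
      rw [pow_succ]
      field_simp

end Convergence

end Glue

theorem mainTheorem1 {d : ℕ} [NeZero d] (m : ℕ)
    (G : Glue.Chain d (2 * m + 1) → Glue.Chain d (2 * m + 1)) (hG : Glue.IsGLUE m G)
    (P : Glue.Chain d (2 * m + 1)) :
    (Glue.Straightened G P → Glue.ConvergentAt G P) ∧
    (Glue.StronglyStraightened G P → Glue.CkAt 1 G P) ∧
    (∀ α : ℝ, 0 < α → α ≤ 1 →
      Glue.StraightenedAtRate α G P → Glue.CkHolderAt 1 α G P) :=
  ⟨fun h => h.convergentAt hG, fun h => h.c1At hG, fun _ hα _ h => h.c1HolderAt hG hα⟩
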